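/- Let $m\ge 2$, $n=2m$, $q=2^n$, let $\mathbb F_q$ be the finite field with $q$ elements and $\theta$ a primitive element of $\mathbb F_q$. Let $1\le k\le m$ be an integer and $1\le t\le 2^m+1$ an odd integer, and put $$s_1=2^{k-1}t-\tfrac{t-1}{2},\quad s_2=2^{k-1}t+\tfrac{t+1}{2},\quad d_1=s_1(2^m-1)+1,\quad d_2=s_2(2^m-1)+1,\quad l=\gcd(t,2^m+1).$$ Let $\mathcal C_{q,d_1,d_2}$ be the binary cyclic code of length $q-1$ with generator polynomial $g_{d_1}(x)g_{d_2}(x)$, where $g_i(x)$ is the minimal polynomial of $\theta^i$ over $\mathbb F_2$, and let $\mathcal C_{q,d_1,d_2}^{\perp}$ be its dual code. Assume that $(2^k-1)t\not\equiv 0$ and $(2^k+1)t\not\equiv 0 \pmod{2^m+1}$, and that $m\equiv -1\pmod k$ or $\gcd(k,2m)=1$. Then $\mathcal C_{q,d_1,d_2}^{\perp}$ is a binary linear code of length $2^n-1$, dimension $4m$ and minimum distance $2^{2m-1}-(3l-1)2^{m-1}$, and its weight distribution is as follows: there is exactly one codeword of weight $0$; there are - $\dfrac{(2^{2m}-1)(2^m+1-2l)(2^m+1-l)}{6l^3}$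 codewords of weight $2^{2m-1}-(3l-1)2^{m-1}$, - $\dfrac{(2^{2m}-1)((2^m+3)l-2^m-1)(2^m+1-l)}{2l^3}$ codewords of weight $2^{2m-1}-(2l-1)2^{m-1}$, - $\dfrac{(2^{2m}-1)((2^{2m+1}+2^{m+2}+6)l^2-(2^{2m+1}+7\cdot 2^m+5)l+(2^m+1)^2)}{2l^3}$ codewords of weight $2^{2m-1}-(l-1)2^{m-1}$, - $\dfrac{(2^{2m}-1)(6(2^{2m}+1)l^3-(6\cdot 2^{2m}+9\cdot 2^m+11)l^2+(3\cdot 2^{2m}+9\cdot 2^m+6)l-(2^m+1)^2)}{6l^3}$ codewords of weight $2^{2m-1}+2^{m-1}$, and there are no codewords of any other weight (in particular, the code has at most four nonzero weights). -/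

import Mathlib

open Polynomial

/-- The polynomial `c₀ + c₁ x + ⋯ + c_{N-1} x^{N-1}` identified with the word `c`. -/
noncomputable def wordPoly {K : Type*} [Field K] {N : ℕ} (c : Fin N → K) : K[X] :=
  ∑ i : Fin N, C (c i) * X ^ (i : ℕ)

/-- The cyclic code of length `N` over `K` generated by `g`: the words whose polynomial lies, in
the quotient ring `K[x] / (x ^ N - 1)`, in the ideal generated by the class of `g`. -/
noncomputable def cyclicCode {K : Type*} [Field K] (N : ℕ) (g : K[X]) :
    Submodule K (Fin N → K) where
  carrier := {c | Ideal.Quotient.mk (Ideal.span {(X ^ N - 1 : K[X])}) (wordPoly c) ∈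
    Ideal.span {Ideal.Quotient.mk (Ideal.span {(X ^ N - 1 : K[X])}) g}}
  add_mem' := by
    intro a b ha hb
    have h : wordPoly (a + b) = wordPoly a + wordPoly b := by
      simp [wordPoly, add_mul, Finset.sum_add_distrib]
    simp only [Set.mem_ofPred_eq] at ha hb ⊢
    rw [h, map_add]
    exact Ideal.add_mem _ ha hb
  zero_mem' := by simp [wordPoly]
  smul_mem' := by
    intro r a ha
    have h : wordPoly (r • a) = C r * wordPoly a := by
      simp [wordPoly, Finset.mul_sum, mul_assoc]
    simp only [Set.mem_ofPred_eq] at ha ⊢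
    rw [h, map_mul]
    exact Ideal.mul_mem_left _ _ ha

/-- The dual code, with respect to the standard bilinear form `∑ i, x i * y i`. -/
def dualCode {K : Type*} [Field K] {N : ℕ} (A : Submodule K (Fin N → K)) :
    Submodule K (Fin N → K) where
  carrier := {x | ∀ y ∈ A, x ⬝ᵥ y = 0}
  add_mem' := by
    intro a b ha hb y hy
    rw [add_dotProduct, ha y hy, hb y hy, add_zero]
  zero_mem' := by
    intro y _
    exact zero_dotProduct y
  smul_mem' := by
    intro r a ha y hy
    rw [smul_dotProduct, ha y hy, smul_zero]

/-- The code `C_{q, d₁, d₂}` of length `N` (to be used with `N = q - 1`) over `ZMod p`: the cyclic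
code with generator polynomial `g_{d₁} g_{d₂}`, where `g_i` is the minimal polynomial of `θ ^ i`
over `ZMod p`. -/
noncomputable def twoZeroCode (p : ℕ) [Fact p.Prime] {F : Type*} [Field F] [Algebra (ZMod p) F]
    (θ : F) (N d₁ d₂ : ℕ) : Submodule (ZMod p) (Fin N → ZMod p) :=
  cyclicCode N (minpoly (ZMod p) (θ ^ d₁) * minpoly (ZMod p) (θ ^ d₂))

/-- `d` is the minimum distance of the code `A`: the least Hamming distance between two distinct
codewords. -/
def IsMinDistance {K : Type*} [Field K] [DecidableEq K] {N : ℕ}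
    (A : Submodule K (Fin N → K)) (d : ℕ) : Prop :=
  IsLeast {e : ℕ | ∃ x ∈ A, ∃ y ∈ A, x ≠ y ∧ hammingDist x y = e} d

/-- The number of codewords of Hamming weight `w` in the code `A`. -/
noncomputable def weightCount {K : Type*} [Field K] [DecidableEq K] {N : ℕ}
    (A : Submodule K (Fin N → K)) (w : ℕ) : ℕ :=
  Set.ncard {c : Fin N → K | c ∈ A ∧ hammingNorm c = w}

/-! Write `Q = 2 ^ m`. By Delsarte's theorem the dual code consists of the words `Tr (f x)`, `x ∈
Fˣ`, where `f x = a x ^ d₁ + b x ^ d₂` (`dualCode_twoZeroCode`). Both exponents are `1` modulo `Q -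
1` (Niho exponents), so `f (y x) = y f x` for `y` in the subfield of order `Q`. Averaging over these
`y` shows that `x` contributes to the weight exactly when `f x + (f x) ^ Q ≠ 0`, and this condition
says that `pairForm` does not vanish at `v = x ^ ((Q - 1) t)`. Such `v` run over a subgroup `G` of
the unit circle `v ^ (Q + 1) = 1`, of order `(Q + 1) / l`. Hence the weight is `2 ^ (m - 1) * l *
(|G| - z)`, with `z` the number of zeros of the form in `G` (`card_trace_binomialEval_ne_zero`).

The distribution of `z` remains. The condition relating `m` and `k` yields `gcd(k, m) = 1`, and then
a nonzero form has at most three zeros on the circle (`pairForm_eq_zero_of_four_zeros`): a zero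
satisfies `v ^ (2 ^ k) = μ v` for a Möbius map `μ`, and also `v ^ Q = 1 / v`, so the cross-ratio of
four zeros would be fixed by two Frobenius powers and lie in the field of two elements. Vanishing at
one point cuts the number of pairs by a factor of at most `Q`; since four points cut `Q ^ 4` pairs
down to one, every factor is exactly `Q` (`card_pairsVanishing`). This gives the binomial moments of
`z`, and a triangular linear system determines the four frequencies. -/

/-! ### Zeros of the forms on the unit circle -/

/-- The polynomial `b x ^ (2 ^ k + 1) + a x ^ (2 ^ k) + a ^ Q x + b ^ Q`, with `Q = 2 ^ m` and
`(a, b) = p`, evaluated at `v`. -/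
def pairForm {F : Type*} [Field F] (m k : ℕ) (v : F) (p : F × F) : F :=
  p.2 * v ^ (2 ^ k + 1) + p.1 * v ^ 2 ^ k + p.1 ^ 2 ^ m * v + p.2 ^ 2 ^ m

/-- The periods of a point under squaring are closed under gcd. -/
lemma sq_eq_self_of_pow_two_pow {F : Type*} [Field F] {m k : ℕ} (h : Nat.gcd k m = 1) {c : F}
    (hk : c ^ 2 ^ k = c) (hm : c ^ 2 ^ m = c) : c ^ 2 = c := by
  have key : ∀ n, c ^ 2 ^ n = c → Function.IsPeriodicPt (fun x : F => x ^ 2) n c := by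
    intro n hn
    have : (fun x : F => x ^ 2)^[n] c = c ^ 2 ^ n := by
      simp
    rwa [Function.IsPeriodicPt, Function.IsFixedPt, this]
  have := (key k hk).gcd (key m hm)
  rw [h] at this
  simpa [Function.IsPeriodicPt, Function.IsFixedPt] using this

/-- Invariance of the cross-ratio under a Möbius map with denominators `Dᵢ` at `vᵢ` and determinant
`Δ`, when this map agrees with the Frobenius power on the four points. The hypotheses are the
difference formula for Möbius maps with denominators cleared. -/
lemma crossRatio_pow_eq_self {F : Type*} [Field F] {v₁ v₂ v₃ v₄ D₁ D₂ D₃ D₄ Δ : F} (k : ℕ)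
    (hD₁ : D₁ ≠ 0) (hD₂ : D₂ ≠ 0) (hD₃ : D₃ ≠ 0) (hD₄ : D₄ ≠ 0) (hΔ : Δ ≠ 0)
    (e14 : v₁ + v₄ ≠ 0) (e23 : v₂ + v₃ ≠ 0)
    (h13 : (v₁ + v₃) ^ 2 ^ k * (D₁ * D₃) = Δ * (v₁ + v₃))
    (h24 : (v₂ + v₄) ^ 2 ^ k * (D₂ * D₄) = Δ * (v₂ + v₄))
    (h14 : (v₁ + v₄) ^ 2 ^ k * (D₁ * D₄) = Δ * (v₁ + v₄))
    (h23 : (v₂ + v₃) ^ 2 ^ k * (D₂ * D₃) = Δ * (v₂ + v₃)) :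
    ((v₁ + v₃) * (v₂ + v₄) / ((v₁ + v₄) * (v₂ + v₃))) ^ 2 ^ k =
      (v₁ + v₃) * (v₂ + v₄) / ((v₁ + v₄) * (v₂ + v₃)) := by
  rw [div_pow, mul_pow, mul_pow, div_eq_div_iff (by positivity) (by positivity)]
  have hne : D₁ * D₂ * D₃ * D₄ * Δ ^ 2 ≠ 0 := by positivity
  apply mul_right_cancel₀ hne
  generalize (v₁ + v₃) ^ 2 ^ k = A at *
  generalize (v₂ + v₄) ^ 2 ^ k = B at *
  generalize (v₁ + v₄) ^ 2 ^ k = C at *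
  generalize (v₂ + v₃) ^ 2 ^ k = D at *
  calc A * B * ((v₁ + v₄) * (v₂ + v₃)) * (D₁ * D₂ * D₃ * D₄ * Δ ^ 2)
      = (A * (D₁ * D₃)) * (B * (D₂ * D₄)) * (Δ * (v₁ + v₄)) * (Δ * (v₂ + v₃)) := by ring
    _ = (Δ * (v₁ + v₃)) * (Δ * (v₂ + v₄)) * (C * (D₁ * D₄)) * (D * (D₂ * D₃)) := by
        rw [h13, h24, h14, h23]
    _ = _ := by ring

section CharTwo

variable {F : Type*} [Field F] [CharP F 2]

lemma add_ne_zero_of_ne_charTwo {x y : F} (h : x ≠ y) : x + y ≠ 0 :=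
  fun h' => h (CharTwo.add_eq_zero.mp h')

/-- The cross-ratio of four distinct elements is not fixed by both `x ↦ x ^ (2 ^ k)` and
`x ↦ x ^ (2 ^ m)` when `k` and `m` are coprime. -/
lemma crossRatio_not_fixed {m k : ℕ} (h : Nat.gcd k m = 1) {v₁ v₂ v₃ v₄ : F}
    (h12 : v₁ ≠ v₂) (h13 : v₁ ≠ v₃) (h14 : v₁ ≠ v₄) (h23 : v₂ ≠ v₃) (h24 : v₂ ≠ v₄)
    (h34 : v₃ ≠ v₄)
    (hk : ((v₁ + v₃) * (v₂ + v₄) / ((v₁ + v₄) * (v₂ + v₃))) ^ 2 ^ k =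
      (v₁ + v₃) * (v₂ + v₄) / ((v₁ + v₄) * (v₂ + v₃)))
    (hm : ((v₁ + v₃) * (v₂ + v₄) / ((v₁ + v₄) * (v₂ + v₃))) ^ 2 ^ m =
      (v₁ + v₃) * (v₂ + v₄) / ((v₁ + v₄) * (v₂ + v₃))) : False := by
  have h2 : (2 : F) = 0 := CharTwo.two_eq_zero
  have e13 := add_ne_zero_of_ne_charTwo h13
  have e24 := add_ne_zero_of_ne_charTwo h24
  have e14 := add_ne_zero_of_ne_charTwo h14
  have e23 := add_ne_zero_of_ne_charTwo h23
  have hsq := sq_eq_self_of_pow_two_pow h hk hm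
  have hne : (v₁ + v₃) * (v₂ + v₄) / ((v₁ + v₄) * (v₂ + v₃)) ≠ 0 := by positivity
  have h1 : (v₁ + v₃) * (v₂ + v₄) / ((v₁ + v₄) * (v₂ + v₃)) = 1 := by
    rw [sq] at hsq
    exact mul_left_cancel₀ hne (by rw [hsq, mul_one])
  rw [div_eq_one_iff_eq (mul_ne_zero e14 e23)] at h1
  have : (v₁ + v₂) * (v₃ + v₄) = 0 := by
    linear_combination h1 + (v₁ * v₃ + v₂ * v₄) * h2
  rcases mul_eq_zero.mp this with h | h
  · exact add_ne_zero_of_ne_charTwo h12 h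
  · exact add_ne_zero_of_ne_charTwo h34 h

/-- If `k` and `m` are coprime, a nonzero form has at most three zeros on the unit circle
`v ^ (2 ^ m + 1) = 1`. -/
lemma pairForm_eq_zero_of_four_zeros {m k : ℕ} (h : Nat.gcd k m = 1) {v₁ v₂ v₃ v₄ : F}
    (h12 : v₁ ≠ v₂) (h13 : v₁ ≠ v₃) (h14 : v₁ ≠ v₄) (h23 : v₂ ≠ v₃) (h24 : v₂ ≠ v₄)
    (h34 : v₃ ≠ v₄)
    (u₁ : v₁ ^ (2 ^ m + 1) = 1) (u₂ : v₂ ^ (2 ^ m + 1) = 1)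
    (u₃ : v₃ ^ (2 ^ m + 1) = 1) (u₄ : v₄ ^ (2 ^ m + 1) = 1) {p : F × F}
    (z₁ : pairForm m k v₁ p = 0) (z₂ : pairForm m k v₂ p = 0)
    (z₃ : pairForm m k v₃ p = 0) (z₄ : pairForm m k v₄ p = 0) : p = 0 := by
  have h2 : (2 : F) = 0 := CharTwo.two_eq_zero
  obtain ⟨a, b⟩ := p
  simp only [pairForm, pow_succ] at z₁ z₂ z₃ z₄ u₁ u₂ u₃ u₄
  -- This is the determinant of the Möbius map `v ↦ (a ^ Q v + b ^ Q) / (b v + a)`. If it vanishes,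
  -- `b` times the form splits into two factors, each with at most one zero, so three of the points
  -- already give a contradiction.
  by_cases hΔ : a * a ^ 2 ^ m + b * b ^ 2 ^ m = 0
  · by_cases hb : b = 0
    · subst hb
      simp at hΔ
      simp [hΔ]
    exfalso
    have fac : ∀ v : F, b * (v ^ 2 ^ k * v) + a * v ^ 2 ^ k + a ^ 2 ^ m * v + b ^ 2 ^ m = 0 →
        v = a / b ∨ v ^ 2 ^ k = a ^ 2 ^ m / b := by
      intro v hv
      have : (b * v + a) * (b * v ^ 2 ^ k + a ^ 2 ^ m) = 0 := by
        linear_combination b * hv + hΔ - (b * b ^ 2 ^ m) * h2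
      rcases mul_eq_zero.mp this with h | h
      · left
        rw [CharTwo.add_eq_zero] at h
        rw [← h]; field_simp
      · right
        rw [CharTwo.add_eq_zero] at h
        rw [← h]; field_simp
    have inj : ∀ x y : F, x ^ 2 ^ k = y ^ 2 ^ k → x = y := fun x y hxy =>
      iterateFrobenius_inj F 2 k (by simpa [iterateFrobenius_def] using hxy)
    have inj' : ∀ {x y : F}, x ≠ y → x ^ 2 ^ k ≠ y ^ 2 ^ k := fun hxy e => hxy (inj _ _ e)
    rcases fac _ z₁ with e1 | e1 <;> rcases fac _ z₂ with e2 | e2 <;>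
      rcases fac _ z₃ with e3 | e3
    · exact h12 (e1.trans e2.symm)
    · exact h12 (e1.trans e2.symm)
    · exact h13 (e1.trans e3.symm)
    · exact inj' h23 (e2.trans e3.symm)
    · exact h23 (e2.trans e3.symm)
    · exact inj' h13 (e1.trans e3.symm)
    · exact inj' h12 (e1.trans e2.symm)
    · exact inj' h12 (e1.trans e2.symm)
  · exfalso
    have den : ∀ v : F, b * (v ^ 2 ^ k * v) + a * v ^ 2 ^ k + a ^ 2 ^ m * v + b ^ 2 ^ m = 0 →
        b * v + a ≠ 0 := by
      intro v hv h0
      apply hΔ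
      linear_combination b * hv - (b * v ^ 2 ^ k + a ^ 2 ^ m) * h0 + (a * a ^ 2 ^ m) * h2
    have diff : ∀ v w : F,
        b * (v ^ 2 ^ k * v) + a * v ^ 2 ^ k + a ^ 2 ^ m * v + b ^ 2 ^ m = 0 →
        b * (w ^ 2 ^ k * w) + a * w ^ 2 ^ k + a ^ 2 ^ m * w + b ^ 2 ^ m = 0 →
        (v + w) ^ 2 ^ k * ((b * v + a) * (b * w + a)) =
          (a * a ^ 2 ^ m + b * b ^ 2 ^ m) * (v + w) := by
      intro v w hv hw
      rw [add_pow_char_pow]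
      linear_combination (b * w + a) * hv + (b * v + a) * hw
        - (a ^ 2 ^ m * v * w * b + b ^ 2 ^ m * a + a * a ^ 2 ^ m * (v + w) +
          b * b ^ 2 ^ m * (v + w)) * h2
    -- The same difference formula for inversion `v ↦ 1 / v`, which is the `Q`-Frobenius on the unit
    -- circle: denominators `v`, `w` and determinant `1`.
    have conj : ∀ v w : F, v ^ 2 ^ m * v = 1 → w ^ 2 ^ m * w = 1 →
        (v + w) ^ 2 ^ m * (v * w) = 1 * (v + w) := by
      intro v w hv hw
      rw [add_pow_char_pow]
      linear_combination w * hv + v * hw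
    have nz : ∀ v : F, v ^ 2 ^ m * v = 1 → v ≠ 0 := by
      rintro v hv rfl
      simp at hv
    have e14 := add_ne_zero_of_ne_charTwo h14
    have e23 := add_ne_zero_of_ne_charTwo h23
    refine crossRatio_not_fixed h h12 h13 h14 h23 h24 h34 ?_ ?_
    · exact crossRatio_pow_eq_self k (den _ z₁) (den _ z₂) (den _ z₃) (den _ z₄) hΔ e14 e23
        (diff _ _ z₁ z₃) (diff _ _ z₂ z₄) (diff _ _ z₁ z₄) (diff _ _ z₂ z₃)
    · exact crossRatio_pow_eq_self m (nz _ u₁) (nz _ u₂) (nz _ u₃) (nz _ u₄) one_ne_zero e14 e23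
        (conj _ _ u₁ u₃) (conj _ _ u₂ u₄) (conj _ _ u₁ u₄) (conj _ _ u₂ u₃)

end CharTwo

/-! ### Counting forms by their number of zeros -/

lemma pairForm_sub {F : Type*} [Field F] [CharP F 2] (m k : ℕ) (v : F) (p r : F × F) :
    pairForm m k v (p - r) = pairForm m k v p - pairForm m k v r := by
  simp only [pairForm, Prod.fst_sub, Prod.snd_sub, sub_pow_char_pow]
  ring

lemma pairForm_zero {F : Type*} [Field F] (m k : ℕ) (v : F) : pairForm m k v 0 = 0 := by
  simp [pairForm]

lemma pow_card_eq_self {F : Type*} [Field F] [Fintype F] {m : ℕ}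
    (hF : Fintype.card F = 2 ^ (2 * m)) (x : F) :
    (x ^ 2 ^ m) ^ 2 ^ m = x := by
  rw [← pow_mul, ← pow_add, ← two_mul, ← hF, FiniteField.pow_card]

lemma card_pow_mul_eq_self_le {F : Type*} [Field F] [Fintype F] [DecidableEq F]
    {m : ℕ} (hm : m ≠ 0) {c : F} (hc : c ≠ 0) :
    (Finset.univ.filter fun z : F => z ^ 2 ^ m * c = z).card ≤ 2 ^ m := by
  have h1 : 1 < 2 ^ m := Nat.one_lt_two_pow hm
  have hd : (C c * X ^ 2 ^ m - X : F[X]).natDegree = 2 ^ m := by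
    rw [natDegree_sub_eq_left_of_natDegree_lt] <;> rw [natDegree_C_mul_X_pow _ _ hc]
    simpa using h1
  have h0 : (C c * X ^ 2 ^ m - X : F[X]) ≠ 0 := by
    intro h
    rw [h, natDegree_zero] at hd
    omega
  refine (Finset.card_le_card ?_).trans
    ((Multiset.toFinset_card_le _).trans ((card_roots' (C c * X ^ 2 ^ m - X : F[X])).trans hd.le))
  intro z hz
  simp only [Finset.mem_filter, Finset.mem_univ, true_and] at hz
  rw [Multiset.mem_toFinset, mem_roots h0, IsRoot.def]
  simp only [eval_sub, eval_mul, eval_C, eval_pow, eval_X]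
  linear_combination hz

/-- The form is self-reciprocal under conjugation, which confines its values at a fixed `v` to the
at most `Q` roots of `z ^ Q * v ^ (2 ^ k + 1) = z`. -/
lemma pairForm_conj {F : Type*} [Field F] [Fintype F] [CharP F 2] {m : ℕ}
    (k : ℕ) (hF : Fintype.card F = 2 ^ (2 * m)) {v : F}
    (hv : v ^ (2 ^ m + 1) = 1) (p : F × F) :
    pairForm m k v p ^ 2 ^ m * v ^ (2 ^ k + 1) = pairForm m k v p := by
  simp only [pairForm, add_pow_char_pow, mul_pow, pow_card_eq_self hF]
  have e : (v ^ 2 ^ m) * v = 1 := by rw [← pow_succ, hv]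
  have e2 : (v ^ 2 ^ k) ^ 2 ^ m * v ^ 2 ^ k = 1 := by
    rw [pow_right_comm, ← mul_pow, e, one_pow]
  rw [pow_succ, mul_pow]
  linear_combination (p.2 ^ 2 ^ m * v ^ 2 ^ m * v + p.1 ^ 2 ^ m * v) * e2
    + (p.1 * v ^ 2 ^ k + p.2 ^ 2 ^ m) * e

section Count

variable {F : Type*} [Field F] [Fintype F] [DecidableEq F] [CharP F 2]

/-- The pairs `p` whose form vanishes on `S`. -/
def pairsVanishing (m k : ℕ) (S : Finset F) : Finset (F × F) :=
  Finset.univ.filter fun p => ∀ v ∈ S, pairForm m k v p = 0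

/-- Evaluation at `v` is additive in the pair and takes at most `Q` values; subtracting one element
of a fibre embeds the fibre in the pairs that also vanish at `v`. -/
lemma card_pairsVanishing_le_insert {m : ℕ} (k : ℕ) (hm : m ≠ 0)
    (hF : Fintype.card F = 2 ^ (2 * m)) {v : F}
    (hv : v ^ (2 ^ m + 1) = 1) (S : Finset F) :
    (pairsVanishing m k S).card ≤ (pairsVanishing m k (insert v S)).card * 2 ^ m := by
  have hv0 : v ≠ 0 := by
    rintro rfl
    simp at hv
  refine (Finset.card_le_mul_card_image (f := pairForm m k v) (pairsVanishing m k S)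
    (pairsVanishing m k (insert v S)).card ?_).trans (Nat.mul_le_mul_left _ ?_)
  · intro z hz
    obtain ⟨p, hp, rfl⟩ := Finset.mem_image.mp hz
    refine Finset.card_le_card_of_injOn (fun r => r - p) ?_ (by intro x _ y _; simp)
    intro r hr
    simp only [pairsVanishing, Finset.coe_filter, Finset.mem_filter, Finset.mem_univ, true_and,
      Set.mem_ofPred_eq, Finset.mem_insert, forall_eq_or_imp, pairForm_sub] at hr hp ⊢
    exact ⟨sub_eq_zero.mpr hr.2, fun w hw => by rw [hr.1 w hw, hp w hw, sub_zero]⟩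
  · refine (Finset.card_le_card ?_).trans
      (card_pow_mul_eq_self_le hm (pow_ne_zero (2 ^ k + 1) hv0))
    intro z hz
    obtain ⟨p, -, rfl⟩ := Finset.mem_image.mp hz
    simpa using pairForm_conj k hF hv p

lemma card_pairsVanishing_le_union {m : ℕ} (k : ℕ) (hm : m ≠ 0)
    (hF : Fintype.card F = 2 ^ (2 * m)) (S T : Finset F) (hT : ∀ v ∈ T, v ^ (2 ^ m + 1) = 1) :
    (pairsVanishing m k S).card ≤ (pairsVanishing m k (T ∪ S)).card * (2 ^ m) ^ T.card := by
  induction T using Finset.induction_on with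
  | empty => simp
  | insert v T hvT ih =>
    rw [Finset.card_insert_of_notMem hvT, pow_succ', ← mul_assoc, Finset.insert_union]
    exact (ih fun w hw => hT w (Finset.mem_insert_of_mem hw)).trans (Nat.mul_le_mul_right _
      (card_pairsVanishing_le_insert k hm hF (hT v (Finset.mem_insert_self _ _)) _))

lemma card_pairsVanishing_of_card_eq_four {m k : ℕ} (hkm : Nat.gcd k m = 1) {T : Finset F}
    (hT : ∀ v ∈ T, v ^ (2 ^ m + 1) = 1) (h4 : 4 ≤ T.card) : pairsVanishing m k T = {0} := by
  obtain ⟨T', hTT', h4'⟩ := Finset.exists_subset_card_eq h4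
  obtain ⟨a, b, c, d, hab, hac, had, hbc, hbd, hcd, rfl⟩ := Finset.card_eq_four.mp h4'
  have ha := hTT' (show a ∈ _ by simp)
  have hb := hTT' (show b ∈ _ by simp)
  have hc := hTT' (show c ∈ _ by simp)
  have hd := hTT' (show d ∈ _ by simp)
  ext p
  simp only [pairsVanishing, Finset.mem_filter, Finset.mem_univ, true_and, Finset.mem_singleton]
  refine ⟨fun h => ?_, ?_⟩
  · exact pairForm_eq_zero_of_four_zeros hkm hab hac had hbc hbd hcd (hT _ ha) (hT _ hb)
      (hT _ hc) (hT _ hd) (h _ ha) (h _ hb) (h _ hc) (h _ hd)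
  · rintro rfl v -
    exact pairForm_zero m k v

lemma card_pairsVanishing {m k : ℕ} (hm : m ≠ 0) (hkm : Nat.gcd k m = 1)
    (hF : Fintype.card F = 2 ^ (2 * m)) {G : Finset F} (hG : ∀ v ∈ G, v ^ (2 ^ m + 1) = 1)
    (h4 : 4 ≤ G.card) {S : Finset F} (hS : S ⊆ G) (hS4 : S.card ≤ 4) :
    (pairsVanishing m k S).card = (2 ^ m) ^ (4 - S.card) := by
  obtain ⟨T, hST, hTG, hT4⟩ := Finset.exists_subsuperset_card_eq hS hS4 h4
  have h0 : (pairsVanishing m k (∅ : Finset F)).card = (2 ^ m) ^ 4 := by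
    simp only [pairsVanishing, Finset.notMem_empty, false_imp_iff, implies_true,
      Finset.filter_true, Finset.card_univ, Fintype.card_prod, hF]
    ring
  -- Enlarging `S` to four points, where only `0` survives, bounds the count above; building `S` up
  -- from `∅`, where there are `Q ^ 4` pairs, bounds it below. The bounds agree.
  have hup := card_pairsVanishing_le_union k hm hF S (T \ S)
    fun v hv => hG v (hTG (Finset.mem_sdiff.mp hv).1)
  rw [Finset.sdiff_union_of_subset hST, card_pairsVanishing_of_card_eq_four hkm
    (fun v hv => hG v (hTG hv)) hT4.ge, Finset.card_sdiff_of_subset hST, hT4] at hup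
  have hlo := card_pairsVanishing_le_union k hm hF ∅ S fun v hv => hG v (hS hv)
  rw [Finset.union_empty, h0] at hlo
  refine le_antisymm (by simpa using hup) ?_
  refine Nat.le_of_mul_le_mul_right ?_ (show 0 < (2 ^ m) ^ S.card by positivity)
  rwa [← pow_add, Nat.sub_add_cancel hS4]

/-- The zeros of the form of `p` in `G`. -/
def formZeros (m k : ℕ) (G : Finset F) (p : F × F) : Finset F :=
  G.filter fun v => pairForm m k v p = 0

/-- Double counting of incidences between pairs `p` and `j`-subsets of `G` on which the form of `p`
vanishes. -/
lemma sum_choose_card_formZeros {m k : ℕ} (hm : m ≠ 0) (hkm : Nat.gcd k m = 1)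
    (hF : Fintype.card F = 2 ^ (2 * m)) {G : Finset F} (hG : ∀ v ∈ G, v ^ (2 ^ m + 1) = 1)
    (h4 : 4 ≤ G.card) {j : ℕ} (hj : j ≤ 4) :
    ∑ p : F × F, (formZeros m k G p).card.choose j = G.card.choose j * (2 ^ m) ^ (4 - j) := by
  have h1 : ∀ p : F × F, (formZeros m k G p).card.choose j =
      (Finset.bipartiteAbove (fun p S => ∀ v ∈ S, pairForm m k v p = 0)
        (G.powersetCard j) p).card := by
    intro p
    rw [← Finset.card_powersetCard]
    congr 1
    ext S
    simp only [Finset.mem_powersetCard, Finset.mem_bipartiteAbove, formZeros]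
    constructor
    · rintro ⟨h, hS⟩
      exact ⟨⟨h.trans (Finset.filter_subset _ _), hS⟩, fun v hv => (Finset.mem_filter.mp (h hv)).2⟩
    · rintro ⟨⟨h, hS⟩, hz⟩
      exact ⟨fun v hv => Finset.mem_filter.mpr ⟨h hv, hz v hv⟩, hS⟩
  simp_rw [h1]
  rw [Finset.sum_card_bipartiteAbove_eq_sum_card_bipartiteBelow, ← Finset.card_powersetCard,
    ← smul_eq_mul, ← Finset.sum_const]
  refine Finset.sum_congr rfl fun S hS => ?_
  obtain ⟨hSG, rfl⟩ := Finset.mem_powersetCard.mp hS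
  exact card_pairsVanishing hm hkm hF hG h4 hSG hj

lemma card_formZeros_le_three {m k : ℕ} (hkm : Nat.gcd k m = 1) {G : Finset F}
    (hG : ∀ v ∈ G, v ^ (2 ^ m + 1) = 1) {p : F × F} (hp : p ≠ 0) :
    (formZeros m k G p).card ≤ 3 := by
  by_contra! h
  have := card_pairsVanishing_of_card_eq_four (T := formZeros m k G p) hkm
    (fun v hv => hG v (Finset.mem_filter.mp hv).1) h
  have hmem : p ∈ pairsVanishing m k (formZeros m k G p) := by
    simp only [pairsVanishing, Finset.mem_filter, Finset.mem_univ, true_and, formZeros]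
    exact fun v hv => hv.2
  rw [this, Finset.mem_singleton] at hmem
  exact hp hmem

/-- The number of nonzero pairs whose form has exactly `i` zeros in `G`. -/
def zeroCountFreq (m k : ℕ) (G : Finset F) (i : ℕ) : ℕ :=
  (Finset.univ.filter fun p : F × F => p ≠ 0 ∧ (formZeros m k G p).card = i).card

/-- The extra `G.card.choose j` on the left is the share of the zero pair, whose form vanishes on
all of `G`. -/
lemma sum_choose_mul_zeroCountFreq {m k : ℕ} (hm : m ≠ 0) (hkm : Nat.gcd k m = 1)
    (hF : Fintype.card F = 2 ^ (2 * m)) {G : Finset F} (hG : ∀ v ∈ G, v ^ (2 ^ m + 1) = 1)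
    (h4 : 4 ≤ G.card) {j : ℕ} (hj : j ≤ 4) :
    ∑ i ∈ Finset.range 4, i.choose j * zeroCountFreq m k G i + G.card.choose j =
      G.card.choose j * (2 ^ m) ^ (4 - j) := by
  rw [← sum_choose_card_formZeros hm hkm hF hG h4 hj, ← Finset.sum_erase_add _ _
    (Finset.mem_univ (0 : F × F))]
  congr 1
  · rw [← Finset.sum_fiberwise_of_maps_to (t := Finset.range 4)
      (g := fun p => (formZeros m k G p).card)]
    · refine Finset.sum_congr rfl fun i _ => ?_
      rw [Finset.sum_congr rfl (g := fun _ => i.choose j), Finset.sum_const, smul_eq_mul, mul_comm]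
      · refine congrArg (· * _) (congrArg Finset.card ?_)
        ext p
        simp
      · intro p hp
        rw [(Finset.mem_filter.mp hp).2]
    · intro p hp
      rw [Finset.mem_range, Nat.lt_succ_iff]
      exact card_formZeros_le_three hkm hG (Finset.mem_erase.mp hp).1
  · simp [formZeros, pairForm_zero]

end Count

/-! ### Power maps on finite cyclic groups -/

section Cyclic

variable {A : Type*} [CommGroup A] [IsCyclic A] [Fintype A] [DecidableEq A]

lemma card_filter_pow_eq_one (e : ℕ) :
    (Finset.univ.filter fun x : A => x ^ e = 1).card = Nat.gcd (Fintype.card A) e := by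
  rw [← Fintype.card_subtype, ← Nat.card_eq_fintype_card, ← Nat.card_eq_fintype_card]
  exact IsCyclic.card_powMonoidHom_ker A e

lemma card_filter_pow_eq_pow (e : ℕ) (y : A) :
    (Finset.univ.filter fun x : A => x ^ e = y ^ e).card = Nat.gcd (Fintype.card A) e := by
  rw [← card_filter_pow_eq_one]
  refine Finset.card_bij (fun x _ => x / y) ?_ ?_ ?_
  · intro x hx
    simpa [div_pow, div_eq_one] using hx
  · intro x _ z _ h
    simpa using h
  · intro x hx
    exact ⟨x * y, by simpa [mul_pow] using hx, by simp⟩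

lemma card_filter_comp_pow (e : ℕ) (P : A → Prop) [DecidablePred P] :
    (Finset.univ.filter fun x : A => P (x ^ e)).card =
      ((Finset.univ.image fun x : A => x ^ e).filter P).card * Nat.gcd (Fintype.card A) e := by
  rw [Finset.card_eq_sum_card_fiberwise (f := fun x : A => x ^ e)
    (t := (Finset.univ.image fun x : A => x ^ e).filter P), ← smul_eq_mul, ← Finset.sum_const]
  · refine Finset.sum_congr rfl fun g hg => ?_
    obtain ⟨hg, hP⟩ := Finset.mem_filter.mp hg
    obtain ⟨y, -, rfl⟩ := Finset.mem_image.mp hg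
    rw [← card_filter_pow_eq_pow e y, Finset.filter_filter]
    refine congrArg Finset.card (Finset.filter_congr fun x _ => ?_)
    constructor
    · exact fun h => h.2
    · exact fun h => ⟨by rw [h]; exact hP, h⟩
  · intro x hx
    simpa using hx

end Cyclic

/-! ### The absolute trace -/

section Trace

variable {F : Type*} [Field F] [Finite F] [Algebra (ZMod 2) F]

lemma trace_pow_two_pow (m : ℕ) (x : F) :
    Algebra.trace (ZMod 2) F (x ^ 2 ^ m) = Algebra.trace (ZMod 2) F x := by
  induction m with
  | zero => simp
  | succ n ih =>
    rw [pow_succ, pow_mul, ← ih]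
    have := Algebra.trace_eq_of_algEquiv (FiniteField.frobeniusAlgEquivOfAlgebraic (ZMod 2) F)
      (x ^ 2 ^ n)
    simpa using this

/-- The `2 * m` conjugates form two identical blocks of length `m`, which cancel in characteristic
2. -/
lemma trace_eq_zero_of_pow_eq_self {m : ℕ} (hF : Module.finrank (ZMod 2) F = 2 * m) {z : F}
    (hz : z ^ 2 ^ m = z) : Algebra.trace (ZMod 2) F z = 0 := by
  have : CharP F 2 := charP_of_injective_algebraMap (algebraMap (ZMod 2) F).injective 2
  apply (algebraMap (ZMod 2) F).injective
  rw [FiniteField.algebraMap_trace_eq_sum_pow, map_zero, hF, two_mul, Finset.sum_range_add,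
    CharTwo.add_eq_zero]
  refine Finset.sum_congr rfl fun i _ => ?_
  rw [Nat.card_zmod, pow_add, pow_mul, hz]

lemma eq_zero_of_forall_trace_mul_eq_zero {w : F}
    (h : ∀ x, Algebra.trace (ZMod 2) F (x * w) = 0) : w = 0 := by
  refine (traceForm_nondegenerate (ZMod 2) F).1 w fun x => ?_
  rw [Algebra.traceForm_apply, mul_comm]
  exact h x

end Trace

/-! ### The unit group and the image of the power map -/

section Units

variable {F : Type*} [Field F] [Fintype F] [DecidableEq F]

lemma card_units_eq {m : ℕ} (hF : Fintype.card F = 2 ^ (2 * m)) :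
    Fintype.card Fˣ = (2 ^ m + 1) * (2 ^ m - 1) := by
  rw [Fintype.card_units, hF, pow_mul', ← Nat.sq_sub_sq, one_pow]

lemma card_filter_pow_eq_self {m : ℕ} (hF : Fintype.card F = 2 ^ (2 * m)) :
    (Finset.univ.filter fun y : F => y ^ 2 ^ m = y).card = 2 ^ m := by
  have h1 := card_filter_pow_eq_one (A := Fˣ) (2 ^ m - 1)
  rw [card_units_eq hF, Nat.gcd_eq_right (dvd_mul_left _ _)] at h1
  have hp : 1 ≤ 2 ^ m := Nat.one_le_two_pow
  have h2 : (Finset.univ.filter fun y : F => y ^ 2 ^ m = y) =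
      insert 0 ((Finset.univ.filter fun x : Fˣ => x ^ (2 ^ m - 1) = 1).image Units.val) := by
    ext y
    simp only [Finset.mem_filter, Finset.mem_univ, true_and, Finset.mem_insert, Finset.mem_image]
    constructor
    · intro hy
      rcases eq_or_ne y 0 with h | h
      · exact Or.inl h
      · refine Or.inr ⟨Units.mk0 y h, ?_, rfl⟩
        ext
        push_cast
        rw [Units.val_mk0]
        apply mul_right_cancel₀ h
        rw [← pow_succ, Nat.sub_add_cancel hp, hy, one_mul]
    · rintro (rfl | ⟨x, hx, rfl⟩)
      · simp
      · have : x ^ 2 ^ m = x := by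
          conv_lhs => rw [← Nat.sub_add_cancel hp, pow_succ, hx, one_mul]
        exact_mod_cast congrArg Units.val this
  rw [h2, Finset.card_insert_of_notMem (by simp),
    Finset.card_image_of_injective _ Units.val_injective,
    h1, Nat.sub_add_cancel hp]

/-- The values on `Fˣ` of the `e`-th power map. -/
def powImage (F : Type*) [Field F] [Fintype F] [DecidableEq F] (e : ℕ) : Finset F :=
  Finset.univ.image fun x : Fˣ => (x : F) ^ e

lemma gcd_card_units {m t : ℕ} (hF : Fintype.card F = 2 ^ (2 * m)) :
    Nat.gcd (Fintype.card Fˣ) ((2 ^ m - 1) * t) = (2 ^ m - 1) * Nat.gcd t (2 ^ m + 1) := by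
  rw [card_units_eq hF, mul_comm (2 ^ m + 1), Nat.gcd_mul_left, Nat.gcd_comm]

lemma card_filter_units_comp_pow {m : ℕ} (t : ℕ) (hF : Fintype.card F = 2 ^ (2 * m))
    (P : F → Prop) [DecidablePred P] :
    (Finset.univ.filter fun x : Fˣ => P ((x : F) ^ ((2 ^ m - 1) * t))).card =
      ((powImage F ((2 ^ m - 1) * t)).filter P).card *
        ((2 ^ m - 1) * Nat.gcd t (2 ^ m + 1)) := by
  have := card_filter_comp_pow (A := Fˣ) ((2 ^ m - 1) * t) (fun x => P (x : F))
  rw [gcd_card_units hF] at this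
  simp only [Units.val_pow_eq_pow_val] at this
  rw [this]
  congr 1
  refine Finset.card_bij (fun y _ => (y : F)) ?_ (fun _ _ _ _ h => Units.ext h) ?_
  · intro y hy
    simp only [Finset.mem_filter, Finset.mem_image, Finset.mem_univ, true_and, powImage] at hy ⊢
    obtain ⟨⟨x, rfl⟩, h⟩ := hy
    exact ⟨⟨x, by simp⟩, h⟩
  · intro y hy
    simp only [Finset.mem_filter, Finset.mem_image, Finset.mem_univ, true_and, powImage] at hy ⊢
    obtain ⟨⟨x, rfl⟩, h⟩ := hy
    exact ⟨x ^ ((2 ^ m - 1) * t), by simpa using h, by simp⟩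

lemma card_powImage {m : ℕ} (hm : m ≠ 0) (t : ℕ) (hF : Fintype.card F = 2 ^ (2 * m)) :
    (powImage F ((2 ^ m - 1) * t)).card * Nat.gcd t (2 ^ m + 1) = 2 ^ m + 1 := by
  have h := card_filter_units_comp_pow t hF fun _ => True
  have h1 : 1 < 2 ^ m := Nat.one_lt_two_pow hm
  simp only [Finset.filter_true, Finset.card_univ, card_units_eq hF] at h
  refine Nat.eq_of_mul_eq_mul_right (show 0 < 2 ^ m - 1 by omega) ?_
  rw [h]
  ring

lemma pow_eq_one_of_mem_powImage {m t : ℕ} (hF : Fintype.card F = 2 ^ (2 * m)) {v : F}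
    (hv : v ∈ powImage F ((2 ^ m - 1) * t)) : v ^ (2 ^ m + 1) = 1 := by
  obtain ⟨x, -, rfl⟩ := Finset.mem_image.mp hv
  have : x ^ Fintype.card Fˣ = 1 := pow_card_eq_one
  rw [← pow_mul, show (2 ^ m - 1) * t * (2 ^ m + 1) = Fintype.card Fˣ * t by
    rw [card_units_eq hF]; ring, pow_mul]
  have h2 : (x : F) ^ Fintype.card Fˣ = 1 := by
    rw [← Units.val_pow_eq_pow_val, this, Units.val_one]
  rw [h2, one_pow]

end Units

/-! ### Niho exponents and the weight formula -/

/-- The function `x ↦ a x ^ d₁ + b x ^ d₂` on the units of `F`, with `(a, b) = p`. -/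
def binomialEval {F : Type*} [Field F] (d₁ d₂ : ℕ) (p : F × F) (x : Fˣ) : F :=
  p.1 * (x : F) ^ d₁ + p.2 * (x : F) ^ d₂

lemma binomialEval_add_conj {F : Type*} [Field F] [Fintype F] [CharP F 2]
    {m k t s₁ s₂ : ℕ} (hF : Fintype.card F = 2 ^ (2 * m))
    (h₁ : s₂ = s₁ + t) (h₂ : 2 * s₂ = (2 ^ k + 1) * t + 1) (p : F × F) (x : Fˣ) :
    binomialEval (s₁ * (2 ^ m - 1) + 1) (s₂ * (2 ^ m - 1) + 1) p x +
      binomialEval (s₁ * (2 ^ m - 1) + 1) (s₂ * (2 ^ m - 1) + 1) p x ^ 2 ^ m = 0 ↔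
    pairForm m k ((x : F) ^ ((2 ^ m - 1) * t)) p = 0 := by
  have hp : 1 ≤ 2 ^ m := Nat.one_le_two_pow
  have hx : (x : F) ≠ 0 := x.ne_zero
  -- In terms of `u`, which lies on the unit circle, `x ^ dᵢ = u ^ sᵢ * x` and its conjugate is `u ^
  -- (1 - sᵢ) * x`. Multiplication by `u ^ s₂` then leaves only powers of `u ^ t`, up to the common
  -- factor `u * x`.
  obtain ⟨u, hu⟩ : ∃ u, u = (x : F) ^ (2 ^ m - 1) := ⟨_, rfl⟩
  have hu0 : u ≠ 0 := hu ▸ pow_ne_zero _ hx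
  have hxu : (x : F) ^ 2 ^ m = u * x := by rw [hu, ← pow_succ, Nat.sub_add_cancel hp]
  have huu : u ^ 2 ^ m * u = 1 := by
    have := pow_card_eq_self hF (x : F)
    rw [hxu, mul_pow, hxu, ← mul_assoc] at this
    exact mul_right_cancel₀ hx (by rw [this, one_mul])
  have hd : ∀ s, (x : F) ^ (s * (2 ^ m - 1) + 1) = u ^ s * x := by
    intro s
    rw [pow_succ, mul_comm s, pow_mul, hu]
  have hdq : ∀ s, ((x : F) ^ (s * (2 ^ m - 1) + 1)) ^ 2 ^ m * u ^ s = u * x := by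
    intro s
    rw [hd, mul_pow, hxu, pow_right_comm]
    calc (u ^ 2 ^ m) ^ s * (u * x) * u ^ s = (u ^ 2 ^ m * u) ^ s * (u * x) := by
          rw [mul_pow]; ring
      _ = _ := by rw [huu, one_pow, one_mul]
  have key : (binomialEval (s₁ * (2 ^ m - 1) + 1) (s₂ * (2 ^ m - 1) + 1) p x +
      binomialEval (s₁ * (2 ^ m - 1) + 1) (s₂ * (2 ^ m - 1) + 1) p x ^ 2 ^ m) * u ^ s₂ =
      u * x * pairForm m k ((x : F) ^ ((2 ^ m - 1) * t)) p := by
    have a1 : u ^ s₂ = u ^ s₁ * u ^ t := by rw [h₁, pow_add]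
    have a2 : u ^ s₂ * u ^ s₂ = (u ^ t) ^ (2 ^ k + 1) * u := by
      rw [← pow_add, ← two_mul, h₂, pow_succ, mul_comm _ t, pow_mul]
    have a3 : u ^ s₁ * u ^ s₂ = (u ^ t) ^ 2 ^ k * u := by
      apply mul_right_cancel₀ (pow_ne_zero t hu0)
      rw [mul_right_comm, ← a1, a2, pow_succ]
      ring
    rw [binomialEval, add_pow_char_pow, mul_pow, mul_pow, pow_mul _ (2 ^ m - 1) t, ← hu, pairForm]
    calc _ = p.1 * (x : F) ^ (s₁ * (2 ^ m - 1) + 1) * u ^ s₂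
          + p.2 * (x : F) ^ (s₂ * (2 ^ m - 1) + 1) * u ^ s₂
          + p.1 ^ 2 ^ m * (((x : F) ^ (s₁ * (2 ^ m - 1) + 1)) ^ 2 ^ m * u ^ s₁) * u ^ t
          + p.2 ^ 2 ^ m * (((x : F) ^ (s₂ * (2 ^ m - 1) + 1)) ^ 2 ^ m * u ^ s₂) := by
            rw [a1]; ring
      _ = _ := by
        rw [hdq, hdq, hd, hd]
        linear_combination (p.1 * x) * a3 + (p.2 * x) * a2
  constructor
  · intro h
    rw [h, zero_mul] at key
    exact (mul_eq_zero.mp key.symm).resolve_left (mul_ne_zero hu0 hx)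
  · intro h
    rw [h, mul_zero] at key
    exact (mul_eq_zero.mp key).resolve_right (pow_ne_zero _ hu0)

lemma binomialEval_mul {F : Type*} [Field F] {m s₁ s₂ : ℕ} (p : F × F)
    {y : Fˣ} (hy : y ^ (2 ^ m - 1) = 1) (x : Fˣ) :
    binomialEval (s₁ * (2 ^ m - 1) + 1) (s₂ * (2 ^ m - 1) + 1) p (y * x) =
      y * binomialEval (s₁ * (2 ^ m - 1) + 1) (s₂ * (2 ^ m - 1) + 1) p x := by
  have h : ∀ s, (y : F) ^ (s * (2 ^ m - 1) + 1) = y := by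
    intro s
    have : y ^ (s * (2 ^ m - 1) + 1) = y := by
      rw [pow_succ, mul_comm s, pow_mul, hy, one_pow, one_mul]
    exact_mod_cast congrArg Units.val this
  simp only [binomialEval, Units.val_mul, mul_pow, h]
  ring

section Weight

variable {F : Type*} [Field F] [Fintype F] [DecidableEq F] [Algebra (ZMod 2) F]

/-- On the subfield of order `Q` the additive map `y ↦ Tr (y w)` is either zero or balanced, and it
is zero exactly when the relative trace `w + w ^ Q` vanishes. -/
lemma card_units_trace_mul_ne_zero {m : ℕ} (hm : m ≠ 0) (hF : Fintype.card F = 2 ^ (2 * m))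
    (w : F) :
    (Finset.univ.filter fun y : Fˣ =>
      y ^ (2 ^ m - 1) = 1 ∧ Algebra.trace (ZMod 2) F (y * w) ≠ 0).card =
      if w + w ^ 2 ^ m = 0 then 0 else 2 ^ (m - 1) := by
  have hchar : CharP F 2 := charP_of_injective_algebraMap (algebraMap (ZMod 2) F).injective 2
  have hp : 1 ≤ 2 ^ m := Nat.one_le_two_pow
  have hfix : ∀ y : Fˣ, y ^ (2 ^ m - 1) = 1 → (y : F) ^ 2 ^ m = y := by
    intro x hx
    have : x ^ 2 ^ m = x := by
      conv_lhs => rw [← Nat.sub_add_cancel hp, pow_succ, hx, one_mul]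
    exact_mod_cast congrArg Units.val this
  have hrank : Module.finrank (ZMod 2) F = 2 * m := by
    have := Module.card_eq_pow_finrank (K := ZMod 2) (V := F)
    rw [hF, ZMod.card] at this
    exact (Nat.pow_right_injective le_rfl this).symm
  split_ifs with hw
  · rw [Finset.card_eq_zero, Finset.filter_eq_empty_iff]
    rintro y - ⟨hy, hne⟩
    refine hne (trace_eq_zero_of_pow_eq_self hrank ?_)
    rw [mul_pow, hfix y hy, CharTwo.add_eq_zero.mp hw]
    rw [CharTwo.add_eq_zero] at hw
    rw [← hw, ← hw]
  · have hex : ∃ y : F, y ^ 2 ^ m = y ∧ Algebra.trace (ZMod 2) F (y * w) ≠ 0 := by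
      by_contra! hcon
      refine hw (eq_zero_of_forall_trace_mul_eq_zero fun x => ?_)
      -- `x + x ^ Q` lies in the subfield, and Frobenius invariance turns its trace against `w` into
      -- `Tr (x * (w + w ^ Q))`.
      have h1 := hcon (x + x ^ 2 ^ m) (by
        rw [add_pow_char_pow, pow_card_eq_self hF, add_comm])
      have h2 := trace_pow_two_pow m (x ^ 2 ^ m * w)
      rw [mul_pow, pow_card_eq_self hF] at h2
      rw [mul_add, map_add, h2, ← map_add, ← add_mul, h1]
    obtain ⟨y₀, hy₀, ht₀⟩ := hex
    have hval : ∀ a b : ZMod 2, a ≠ 0 → (b ≠ 0 ↔ b + a = 0) := by decide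
    set K := Finset.univ.filter fun y : F => y ^ 2 ^ m = y with hK
    have e1 : (Finset.univ.filter fun y : Fˣ =>
        y ^ (2 ^ m - 1) = 1 ∧ Algebra.trace (ZMod 2) F (y * w) ≠ 0).card =
        (K.filter fun y => Algebra.trace (ZMod 2) F (y * w) ≠ 0).card := by
      refine Finset.card_bij (fun y _ => (y : F)) ?_ (fun _ _ _ _ h => Units.ext h) ?_
      · intro y hy
        simp only [Finset.mem_filter, Finset.mem_univ, true_and, hK] at hy ⊢
        exact ⟨hfix y hy.1, hy.2⟩
      · intro y hy
        simp only [Finset.mem_filter, Finset.mem_univ, true_and, hK] at hy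
        have h0 : y ≠ 0 := by
          rintro rfl
          simp at hy
        refine ⟨Units.mk0 y h0, ?_, rfl⟩
        simp only [Finset.mem_filter, Finset.mem_univ, true_and]
        refine ⟨?_, hy.2⟩
        ext
        push_cast
        rw [Units.val_mk0]
        apply mul_right_cancel₀ h0
        rw [← pow_succ, Nat.sub_add_cancel hp, hy.1, one_mul]
    -- Translation by `y₀`, where the trace is `1`, swaps the two trace values.
    have e2 : (K.filter fun y => Algebra.trace (ZMod 2) F (y * w) ≠ 0).card =
        (K.filter fun y => ¬ Algebra.trace (ZMod 2) F (y * w) ≠ 0).card := by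
      refine Finset.card_bij (fun y _ => y + y₀) ?_ (fun _ _ _ _ h => add_right_cancel h) ?_
      · intro y hy
        simp only [Finset.mem_filter, Finset.mem_univ, true_and, hK] at hy ⊢
        rw [not_not, add_mul, map_add, ← hval _ _ ht₀, add_pow_char_pow, hy.1, hy₀]
        exact ⟨rfl, hy.2⟩
      · intro y hy
        simp only [Finset.mem_filter, Finset.mem_univ, true_and, hK, not_not] at hy
        refine ⟨y + y₀, ?_, by rw [add_assoc, CharTwo.add_self_eq_zero, add_zero]⟩
        simp only [Finset.mem_filter, Finset.mem_univ, true_and, hK]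
        rw [add_pow_char_pow, hy.1, hy₀, add_mul, map_add, hy.2, zero_add]
        exact ⟨rfl, ht₀⟩
    have e3 := Finset.card_filter_add_card_filter_not (s := K)
      (fun y => Algebra.trace (ZMod 2) F (y * w) ≠ 0)
    rw [card_filter_pow_eq_self hF, ← e2, ← e1] at e3
    have e4 : 2 * 2 ^ (m - 1) = 2 ^ m := mul_pow_sub_one hm 2
    omega

/-- The weight of the trace word of `p`, in terms of the number of zeros of the form of `p`. -/
lemma card_trace_binomialEval_ne_zero {m k t s₁ s₂ : ℕ} (hm : m ≠ 0)
    (hF : Fintype.card F = 2 ^ (2 * m))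
    (h₁ : s₂ = s₁ + t) (h₂ : 2 * s₂ = (2 ^ k + 1) * t + 1) (p : F × F) :
    (Finset.univ.filter fun x : Fˣ => Algebra.trace (ZMod 2) F
      (binomialEval (s₁ * (2 ^ m - 1) + 1) (s₂ * (2 ^ m - 1) + 1) p x) ≠ 0).card =
      2 ^ (m - 1) * (Nat.gcd t (2 ^ m + 1) * ((powImage F ((2 ^ m - 1) * t)).card -
        (formZeros m k (powImage F ((2 ^ m - 1) * t)) p).card)) := by
  have hchar : CharP F 2 := charP_of_injective_algebraMap (algebraMap (ZMod 2) F).injective 2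
  have h1 : 1 < 2 ^ m := Nat.one_lt_two_pow hm
  set f := binomialEval (s₁ * (2 ^ m - 1) + 1) (s₂ * (2 ^ m - 1) + 1) p with hf
  set H := Finset.univ.filter fun y : Fˣ => y ^ (2 ^ m - 1) = 1 with hH
  have hHc : H.card = 2 ^ m - 1 := by
    rw [hH, card_filter_pow_eq_one, card_units_eq hF, Nat.gcd_eq_right (dvd_mul_left _ _)]
  -- Double counting of pairs `(y, x)` with `Tr (y * f x) ≠ 0`: every `y ∈ H` contributes the same
  -- weight, because `y * f x = f (y * x)`.
  have h3 := Finset.sum_card_bipartiteAbove_eq_sum_card_bipartiteBelow (s := H)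
    (t := (Finset.univ : Finset Fˣ))
    (fun (y : Fˣ) x => Algebra.trace (ZMod 2) F (y * f x) ≠ 0)
  have h4 : ∀ y ∈ H, ((Finset.univ : Finset Fˣ).bipartiteAbove
      (fun (y : Fˣ) x => Algebra.trace (ZMod 2) F (y * f x) ≠ 0) y).card =
      (Finset.univ.filter fun x : Fˣ => Algebra.trace (ZMod 2) F (f x) ≠ 0).card := by
    intro y hy
    refine Finset.card_bij (fun x _ => y * x) ?_ (fun _ _ _ _ h => mul_left_cancel h) ?_
    · intro x hx
      simpa [Finset.mem_bipartiteAbove, hf, binomialEval_mul p (Finset.mem_filter.mp hy).2] using hx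
    · intro x hx
      refine ⟨y⁻¹ * x, ?_, by simp⟩
      rw [Finset.mem_bipartiteAbove]
      refine ⟨Finset.mem_univ _, ?_⟩
      rw [hf, ← binomialEval_mul p (Finset.mem_filter.mp hy).2, mul_inv_cancel_left]
      exact (Finset.mem_filter.mp hx).2
  have h5 : ∀ x ∈ (Finset.univ : Finset Fˣ), (H.bipartiteBelow
      (fun (y : Fˣ) x => Algebra.trace (ZMod 2) F (y * f x) ≠ 0) x).card =
      if pairForm m k ((x : F) ^ ((2 ^ m - 1) * t)) p ≠ 0 then 2 ^ (m - 1) else 0 := by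
    intro x _
    rw [Finset.bipartiteBelow, hH, Finset.filter_filter, card_units_trace_mul_ne_zero hm hF (f x)]
    simp only [hf, binomialEval_add_conj hF h₁ h₂ p x, ne_eq, ite_not]
  rw [Finset.sum_congr rfl h4, Finset.sum_congr rfl h5, Finset.sum_const, hHc, smul_eq_mul,
    ← Finset.sum_filter, Finset.sum_const, smul_eq_mul,
    card_filter_units_comp_pow t hF fun v => pairForm m k v p ≠ 0] at h3
  have h6 := Finset.card_filter_add_card_filter_not (s := powImage F ((2 ^ m - 1) * t))
    (fun v => pairForm m k v p = 0)
  rw [← formZeros] at h6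
  rw [← h6, Nat.add_sub_cancel_left]
  refine Nat.eq_of_mul_eq_mul_left (show 0 < 2 ^ m - 1 by omega) ?_
  rw [h3]
  ring

end Weight

/-! ### Duality and trace words -/

lemma mem_dualCode_iff {K : Type*} [Field K] {N : ℕ} {A : Submodule K (Fin N → K)}
    {x : Fin N → K} : x ∈ dualCode A ↔ ∀ y ∈ A, x ⬝ᵥ y = 0 := Iff.rfl

lemma dualCode_dualCode {K : Type*} [Field K] {N : ℕ} (A : Submodule K (Fin N → K)) :
    dualCode (dualCode A) = A := by
  let B : LinearMap.BilinForm K (Fin N → K) := dotProductBilin K K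
  have hB : ∀ x y, B x y = x ⬝ᵥ y := fun _ _ => rfl
  have hnd : B.Nondegenerate :=
    ⟨fun x hx => dotProduct_eq_zero x hx,
      fun x hx => dotProduct_eq_zero x fun y => by rw [dotProduct_comm]; exact hx y⟩
  have hrefl : B.IsRefl := fun x y h => by rwa [hB, dotProduct_comm, ← hB]
  have hdual : ∀ C, dualCode C = B.orthogonal C := by
    intro C
    ext x
    simp only [mem_dualCode_iff, LinearMap.BilinForm.mem_orthogonal_iff, hB, dotProduct_comm x]
  rw [hdual, hdual, LinearMap.BilinForm.orthogonal_orthogonal hnd hrefl]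

lemma aeval_wordPoly {K F : Type*} [Field K] [Field F] [Algebra K F] {N : ℕ} (c : Fin N → K)
    (z : F) : aeval z (wordPoly c) = ∑ i : Fin N, algebraMap K F (c i) * z ^ (i : ℕ) := by
  simp [wordPoly]

/-- A word lies in the code `C_{q, d₁, d₂}` exactly when its polynomial vanishes at `θ ^ d₁` and
`θ ^ d₂`. -/
lemma mem_twoZeroCode_iff {p : ℕ} [Fact p.Prime] {F : Type*} [Field F] [Algebra (ZMod p) F]
    {θ : F} {N : ℕ} (hN : (N : ZMod p) ≠ 0) (hθ : θ ^ N = 1) (d₁ d₂ : ℕ) (c : Fin N → ZMod p) :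
    c ∈ twoZeroCode p θ N d₁ d₂ ↔
      aeval (θ ^ d₁) (wordPoly c) = 0 ∧ aeval (θ ^ d₂) (wordPoly c) = 0 := by
  have hroot : ∀ d, aeval (θ ^ d) (X ^ N - 1 : (ZMod p)[X]) = 0 := by
    intro d
    simp [pow_right_comm θ d N, hθ]
  set g₁ := minpoly (ZMod p) (θ ^ d₁)
  set g₂ := minpoly (ZMod p) (θ ^ d₂)
  have hmem : c ∈ twoZeroCode p θ N d₁ d₂ ↔
      ∃ e, (X ^ N - 1 : (ZMod p)[X]) ∣ e * (g₁ * g₂) - wordPoly c := by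
    change Ideal.Quotient.mk (Ideal.span {(X ^ N - 1 : (ZMod p)[X])}) (wordPoly c) ∈
      Ideal.span {Ideal.Quotient.mk (Ideal.span {(X ^ N - 1 : (ZMod p)[X])}) (g₁ * g₂)} ↔ _
    rw [Ideal.mem_span_singleton', Ideal.Quotient.mk_surjective.exists]
    simp only [← map_mul, Ideal.Quotient.eq, Ideal.mem_span_singleton]
  rw [hmem]
  constructor
  · rintro ⟨e, r, hr⟩
    rw [sub_eq_iff_eq_add, ← sub_eq_iff_eq_add'] at hr
    constructor <;> rw [← hr, map_sub, map_mul _ _ r, hroot] <;> simp [g₁, g₂]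
  · rintro ⟨h₁, h₂⟩
    have hsep : (X ^ N - 1 : (ZMod p)[X]).Separable := by
      simpa using separable_X_pow_sub_C (1 : ZMod p) hN one_ne_zero
    -- Modulo `X ^ N - 1`, `g₁ * g₂` generates the same ideal as `D`. Since `D` is squarefree and
    -- divides `g₁ * g₂`, which divides the square of the word polynomial, it divides the word
    -- polynomial itself; coprimality of `g₁` and `g₂` plays no role.
    set D := EuclideanDomain.gcd (g₁ * g₂) (X ^ N - 1) with hD
    have hDN : D ∣ X ^ N - 1 := EuclideanDomain.gcd_dvd_right _ _
    have hDg : D ∣ g₁ * g₂ := EuclideanDomain.gcd_dvd_left _ _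
    have hDsq : Squarefree D := hsep.squarefree.squarefree_of_dvd hDN
    have hDc : D ∣ wordPoly c := by
      refine hDsq.isRadical 2 _ (hDg.trans ?_)
      rw [sq]
      exact mul_dvd_mul (minpoly.dvd _ _ h₁) (minpoly.dvd _ _ h₂)
    obtain ⟨e, he⟩ := hDc
    rw [hD, EuclideanDomain.gcd_eq_gcd_ab] at he
    refine ⟨EuclideanDomain.gcdA (g₁ * g₂) (X ^ N - 1) * e,
      -(EuclideanDomain.gcdB (g₁ * g₂) (X ^ N - 1) * e), ?_⟩
    rw [he]
    ring

/-- The word with entries `Tr (a (θ ^ i) ^ d₁ + b (θ ^ i) ^ d₂)`, as a linear function of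
`(a, b)`. -/
noncomputable def traceWord {F : Type*} [Field F] [Algebra (ZMod 2) F] (θ : F)
    (N d₁ d₂ : ℕ) : F × F →ₗ[ZMod 2] (Fin N → ZMod 2) :=
  LinearMap.pi fun i => (Algebra.trace (ZMod 2) F).comp
    ((LinearMap.mulRight (ZMod 2) ((θ ^ (i : ℕ)) ^ d₁)).comp (LinearMap.fst (ZMod 2) F F) +
      (LinearMap.mulRight (ZMod 2) ((θ ^ (i : ℕ)) ^ d₂)).comp (LinearMap.snd (ZMod 2) F F))

lemma traceWord_apply {F : Type*} [Field F] [Algebra (ZMod 2) F] (θ : F) (N d₁ d₂ : ℕ)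
    (p : F × F) (i : Fin N) :
    traceWord θ N d₁ d₂ p i = Algebra.trace (ZMod 2) F
      (p.1 * (θ ^ (i : ℕ)) ^ d₁ + p.2 * (θ ^ (i : ℕ)) ^ d₂) := rfl

lemma traceWord_dotProduct {F : Type*} [Field F] [Algebra (ZMod 2) F] (θ : F) {N : ℕ}
    (d₁ d₂ : ℕ) (p : F × F) (c : Fin N → ZMod 2) :
    c ⬝ᵥ traceWord θ N d₁ d₂ p = Algebra.trace (ZMod 2) F
      (p.1 * aeval (θ ^ d₁) (wordPoly c) + p.2 * aeval (θ ^ d₂) (wordPoly c)) := by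
  rw [aeval_wordPoly, aeval_wordPoly, Finset.mul_sum, Finset.mul_sum, ← Finset.sum_add_distrib,
    map_sum, dotProduct]
  refine Finset.sum_congr rfl fun i _ => ?_
  rw [traceWord_apply, ← smul_eq_mul, ← map_smul, Algebra.smul_def, pow_right_comm θ i d₁,
    pow_right_comm θ i d₂]
  congr 1
  ring

section TraceWord

variable {F : Type*} [Field F] [Finite F] [Algebra (ZMod 2) F]

/-- Delsarte's description of the dual code by trace words. -/
lemma dualCode_twoZeroCode {θ : F} {N : ℕ} (hN : (N : ZMod 2) ≠ 0) (hθ : θ ^ N = 1)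
    (d₁ d₂ : ℕ) :
    dualCode (twoZeroCode 2 θ N d₁ d₂) = LinearMap.range (traceWord θ N d₁ d₂) := by
  -- Passing to the double dual, it suffices that the words orthogonal to all trace words are those
  -- vanishing at `θ ^ d₁` and `θ ^ d₂`, which is nondegeneracy of the trace form.
  rw [← dualCode_dualCode (LinearMap.range (traceWord θ N d₁ d₂))]
  congr 1
  ext c
  rw [mem_twoZeroCode_iff hN hθ, mem_dualCode_iff]
  simp only [LinearMap.mem_range, forall_exists_index, forall_apply_eq_imp_iff,
    traceWord_dotProduct]
  constructor
  · rintro ⟨h₁, h₂⟩ p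
    simp [h₁, h₂]
  · intro h
    exact ⟨eq_zero_of_forall_trace_mul_eq_zero fun x => by simpa using h (x, 0),
      eq_zero_of_forall_trace_mul_eq_zero fun x => by simpa using h (0, x)⟩

end TraceWord

lemma hammingNorm_traceWord {F : Type*} [Field F] [Fintype F] [DecidableEq F]
    [Algebra (ZMod 2) F] {θ : F} {N : ℕ} (hθ : IsPrimitiveRoot θ N)
    (hN : Fintype.card Fˣ = N) (d₁ d₂ : ℕ) (p : F × F) :
    hammingNorm (traceWord θ N d₁ d₂ p) = (Finset.univ.filter fun x : Fˣ =>
      Algebra.trace (ZMod 2) F (binomialEval d₁ d₂ p x) ≠ 0).card := by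
  have hN0 : N ≠ 0 := hN ▸ Fintype.card_ne_zero
  obtain ⟨u, rfl⟩ := hθ.isUnit hN0
  have hbij : Function.Bijective fun i : Fin N => u ^ (i : ℕ) := by
    rw [Fintype.bijective_iff_injective_and_card, hN, Fintype.card_fin]
    exact ⟨fun i j h => Fin.ext ((IsPrimitiveRoot.coe_units_iff.mp hθ).pow_inj i.2 j.2 h), rfl⟩
  refine Finset.card_bij (fun i _ => u ^ (i : ℕ)) ?_ (fun i _ j _ h => hbij.1 h) ?_
  · intro i hi
    simpa [traceWord_apply, binomialEval] using hi
  · intro x hx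
    obtain ⟨i, rfl⟩ := hbij.2 x
    exact ⟨i, by simpa [traceWord_apply, binomialEval] using hx, rfl⟩

/-! ### The weight distribution -/

/-- `L` is odd and divides neither `2 ^ k - 1` nor `2 ^ k + 1`, whereas `1` divides both and `3`
divides one of them. Applied to `L = |G|`, this supplies the four points needed for the moments and
makes the weights of nonzero pairs positive. -/
lemma five_le_of_mul_gcd_eq {m k t L : ℕ} (hm : m ≠ 0)
    (hL : L * Nat.gcd t (2 ^ m + 1) = 2 ^ m + 1)
    (h₁ : ¬ (2 ^ k - 1) * t ≡ 0 [MOD 2 ^ m + 1])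
    (h₂ : ¬ (2 ^ k + 1) * t ≡ 0 [MOD 2 ^ m + 1]) : 5 ≤ L := by
  have hdvd : ∀ c, L ∣ c → c * t ≡ 0 [MOD 2 ^ m + 1] := by
    intro c hc
    rw [Nat.modEq_zero_iff_dvd]
    conv_lhs => rw [← hL]
    exact mul_dvd_mul hc (Nat.gcd_dvd_left _ _)
  have n₁ : ¬ L ∣ 2 ^ k - 1 := fun h => h₁ (hdvd _ h)
  have n₂ : ¬ L ∣ 2 ^ k + 1 := fun h => h₂ (hdvd _ h)
  have hodd : L % 2 = 1 := by
    have h1 : (2 ^ m + 1) % 2 = 1 := by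
      obtain ⟨n, rfl⟩ := Nat.exists_eq_succ_of_ne_zero hm
      rw [Nat.succ_eq_add_one, pow_succ]
      omega
    rw [← hL, Nat.mul_mod] at h1
    rcases Nat.mod_two_eq_zero_or_one L with h | h
    · rw [h] at h1
      simp at h1
    · exact h
  by_contra! hlt
  have hcases : L = 1 ∨ L = 3 := by omega
  rcases hcases with rfl | rfl
  · exact n₁ (one_dvd _)
  · have h3 : ∀ n, 2 ^ n % 3 = 1 ∨ 2 ^ n % 3 = 2 := by
      intro n
      induction n with
      | zero => simp
      | succ n ih => rw [pow_succ]; omega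
    have := h3 k
    omega

lemma cast_choose_three (n : ℕ) : (n.choose 3 : ℚ) = n * (n - 1) * (n - 2) / 6 := by
  induction n with
  | zero => simp
  | succ n ih =>
    rw [Nat.choose_succ_succ, Nat.cast_add, ih, Nat.cast_choose_two]
    push_cast
    ring

lemma weightCount_range {K V : Type*} [Field K] [DecidableEq K] [AddCommGroup V] [Module K V]
    [Fintype V] {N : ℕ} {T : V →ₗ[K] (Fin N → K)} (hT : Function.Injective T) (w : ℕ) :
    weightCount (LinearMap.range T) w =
      (Finset.univ.filter fun p => hammingNorm (T p) = w).card := by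
  rw [weightCount, ← Set.ncard_coe_finset, ← Set.ncard_image_of_injective _ hT]
  congr 1
  ext c
  constructor
  · rintro ⟨⟨p, rfl⟩, h⟩
    exact ⟨p, by simpa using h, rfl⟩
  · rintro ⟨p, hp, rfl⟩
    exact ⟨⟨p, rfl⟩, by simpa using hp⟩

lemma isMinDistance_of_hammingNorm {K : Type*} [Field K] [DecidableEq K] {N : ℕ}
    {A : Submodule K (Fin N → K)} {d : ℕ} (hle : ∀ c ∈ A, c ≠ 0 → d ≤ hammingNorm c)
    (hex : ∃ c ∈ A, c ≠ 0 ∧ hammingNorm c = d) : IsMinDistance A d := by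
  constructor
  · obtain ⟨c, hc, hc0, rfl⟩ := hex
    exact ⟨c, hc, 0, A.zero_mem, hc0, hammingDist_zero_right c⟩
  · rintro e ⟨x, hx, y, hy, hxy, rfl⟩
    rw [hammingDist_eq_hammingNorm]
    exact hle _ (A.add_mem (A.neg_mem hx) hy) (by rwa [Ne, neg_add_eq_zero])

theorem theorem4 {F : Type*} [Field F] [Algebra (ZMod 2) F]
    (m k t s₁ s₂ d₁ d₂ l : ℕ) (θ : F)
    (hm : 2 ≤ m) (hF : Nat.card F = 2 ^ (2 * m))
    (hθ : IsPrimitiveRoot θ (2 ^ (2 * m) - 1))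
    (hk : 1 ≤ k ∧ k ≤ m) (ht : Odd t) (ht' : 1 ≤ t ∧ t ≤ 2 ^ m + 1)
    (hs₁ : (s₁ : ℚ) = 2 ^ (k - 1) * (t : ℚ) - ((t : ℚ) - 1) / 2)
    (hs₂ : (s₂ : ℚ) = 2 ^ (k - 1) * (t : ℚ) + ((t : ℚ) + 1) / 2)
    (hd₁ : d₁ = s₁ * (2 ^ m - 1) + 1)
    (hd₂ : d₂ = s₂ * (2 ^ m - 1) + 1)
    (hnd₁ : ¬ (2 ^ k - 1) * t ≡ 0 [MOD 2 ^ m + 1])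
    (hnd₂ : ¬ (2 ^ k + 1) * t ≡ 0 [MOD 2 ^ m + 1])
    (hl : l = Nat.gcd t (2 ^ m + 1))
    (hcond : (m : ℤ) ≡ -1 [ZMOD (k : ℤ)] ∨ Nat.gcd k (2 * m) = 1) :
    Module.finrank (ZMod 2) (dualCode (twoZeroCode 2 θ (2 ^ (2 * m) - 1) d₁ d₂)) = 4 * m ∧
    ∃ w₁ w₂ w₃ w₄ : ℕ,
      (w₁ : ℤ) = 2 ^ (2 * m - 1) - (3 * (l : ℤ) - 1) * 2 ^ (m - 1) ∧
      (w₂ : ℤ) = 2 ^ (2 * m - 1) - (2 * (l : ℤ) - 1) * 2 ^ (m - 1) ∧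
      (w₃ : ℤ) = 2 ^ (2 * m - 1) - ((l : ℤ) - 1) * 2 ^ (m - 1) ∧
      (w₄ : ℤ) = 2 ^ (2 * m - 1) + 2 ^ (m - 1) ∧
      IsMinDistance (dualCode (twoZeroCode 2 θ (2 ^ (2 * m) - 1) d₁ d₂)) w₁ ∧
      weightCount (dualCode (twoZeroCode 2 θ (2 ^ (2 * m) - 1) d₁ d₂)) 0 = 1 ∧
      (weightCount (dualCode (twoZeroCode 2 θ (2 ^ (2 * m) - 1) d₁ d₂)) w₁ : ℚ) =
        (2 ^ (2 * m) - 1) * (2 ^ m + 1 - 2 * (l : ℚ)) * (2 ^ m + 1 - (l : ℚ)) /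
          (6 * (l : ℚ) ^ 3) ∧
      (weightCount (dualCode (twoZeroCode 2 θ (2 ^ (2 * m) - 1) d₁ d₂)) w₂ : ℚ) =
        (2 ^ (2 * m) - 1) * ((2 ^ m + 3) * (l : ℚ) - 2 ^ m - 1) * (2 ^ m + 1 - (l : ℚ)) /
          (2 * (l : ℚ) ^ 3) ∧
      (weightCount (dualCode (twoZeroCode 2 θ (2 ^ (2 * m) - 1) d₁ d₂)) w₃ : ℚ) =
        (2 ^ (2 * m) - 1) *
          ((2 ^ (2 * m + 1) + 2 ^ (m + 2) + 6) * (l : ℚ) ^ 2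
            - (2 ^ (2 * m + 1) + 7 * 2 ^ m + 5) * (l : ℚ) + (2 ^ m + 1) ^ 2) /
          (2 * (l : ℚ) ^ 3) ∧
      (weightCount (dualCode (twoZeroCode 2 θ (2 ^ (2 * m) - 1) d₁ d₂)) w₄ : ℚ) =
        (2 ^ (2 * m) - 1) *
          (6 * (2 ^ (2 * m) + 1) * (l : ℚ) ^ 3
            - (6 * 2 ^ (2 * m) + 9 * 2 ^ m + 11) * (l : ℚ) ^ 2
            + (3 * 2 ^ (2 * m) + 9 * 2 ^ m + 6) * (l : ℚ) - (2 ^ m + 1) ^ 2) /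
          (6 * (l : ℚ) ^ 3) ∧
      ∀ w : ℕ, w ≠ 0 → w ≠ w₁ → w ≠ w₂ → w ≠ w₃ → w ≠ w₄ →
        weightCount (dualCode (twoZeroCode 2 θ (2 ^ (2 * m) - 1) d₁ d₂)) w = 0 := by
  classical
  have hfin : Finite F := Nat.finite_of_card_ne_zero (by rw [hF]; positivity)
  let _ : Fintype F := Fintype.ofFinite F
  rw [Nat.card_eq_fintype_card] at hF
  have hchar : CharP F 2 := charP_of_injective_algebraMap (algebraMap (ZMod 2) F).injective 2
  have hm0 : m ≠ 0 := by omega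
  have hkm : Nat.gcd k m = 1 := by
    rcases hcond with h | h
    · obtain ⟨c, hc⟩ := h.symm.dvd
      have h1 : ((Nat.gcd k m : ℕ) : ℤ) ∣ 1 := by
        have hgk : ((Nat.gcd k m : ℕ) : ℤ) ∣ k := Int.natCast_dvd_natCast.mpr (Nat.gcd_dvd_left k m)
        have hgm : ((Nat.gcd k m : ℕ) : ℤ) ∣ m :=
          Int.natCast_dvd_natCast.mpr (Nat.gcd_dvd_right k m)
        have : (1 : ℤ) = k * c - m := by rw [← hc]; ring
        rw [this]
        exact dvd_sub (hgk.mul_right c) hgm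
      exact_mod_cast Int.eq_one_of_dvd_one (by positivity) h1
    · exact Nat.Coprime.coprime_mul_left_right h
  have hst : s₂ = s₁ + t := by
    have : (s₂ : ℚ) = s₁ + t := by rw [hs₁, hs₂]; ring
    exact_mod_cast this
  have hs2 : 2 * s₂ = (2 ^ k + 1) * t + 1 := by
    have : (2 : ℚ) * s₂ = (2 ^ k + 1) * t + 1 := by
      rw [hs₂, ← mul_pow_sub_one (show k ≠ 0 by omega) (2 : ℚ)]
      ring
    exact_mod_cast this
  obtain ⟨N, hN⟩ : ∃ N, N = 2 ^ (2 * m) - 1 := ⟨_, rfl⟩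
  rw [← hN] at hθ ⊢
  have hcardU : Fintype.card Fˣ = N := by rw [Fintype.card_units, hF, hN]
  have hN2 : (N : ZMod 2) ≠ 0 := by
    rw [Ne, ZMod.natCast_eq_zero_iff]
    have : 2 ^ (2 * m) = 2 * 2 ^ (2 * m - 1) := (mul_pow_sub_one (by omega) 2).symm
    have : 0 < 2 ^ (2 * m - 1) := by positivity
    omega
  rw [dualCode_twoZeroCode hN2 hθ.pow_eq_one]
  set T := traceWord θ N d₁ d₂ with hT
  set G := powImage F ((2 ^ m - 1) * t) with hGdef
  have hG : ∀ v ∈ G, v ^ (2 ^ m + 1) = 1 := fun v hv => pow_eq_one_of_mem_powImage hF hv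
  have hGl : G.card * l = 2 ^ m + 1 := hl ▸ card_powImage hm0 t hF
  have hG5 : 5 ≤ G.card := five_le_of_mul_gcd_eq hm0 (hl ▸ hGl) hnd₁ hnd₂
  have hl0 : 0 < l := Nat.pos_of_ne_zero fun h => by simp [h] at hGl
  have hnorm : ∀ p, hammingNorm (T p) =
      2 ^ (m - 1) * (l * (G.card - (formZeros m k G p).card)) := by
    intro p
    rw [hT, hammingNorm_traceWord hθ hcardU, hd₁, hd₂,
      card_trace_binomialEval_ne_zero hm0 hF hst hs2, ← hl]
  have hle3 : ∀ p, p ≠ 0 → (formZeros m k G p).card ≤ 3 := fun p hp =>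
    card_formZeros_le_three hkm hG hp
  have hp0 : 0 < 2 ^ (m - 1) := by positivity
  have hpos : ∀ i, i ≤ 3 → 0 < 2 ^ (m - 1) * (l * (G.card - i)) := by
    intro i hi
    have : 0 < G.card - i := by omega
    positivity
  -- At most three of at least five points are zeros, so a nonzero pair gives a word of positive
  -- weight; the dimension is therefore that of `F × F`.
  have hinj : Function.Injective T := by
    rw [← LinearMap.ker_eq_bot, LinearMap.ker_eq_bot']
    intro p hTp
    by_contra hp
    have h1 := hpos _ (hle3 p hp)
    rw [← hnorm, hTp, hammingNorm_zero] at h1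
    exact lt_irrefl _ h1
  have hcount : ∀ i, i ≤ 3 →
      weightCount (LinearMap.range T) (2 ^ (m - 1) * (l * (G.card - i))) =
        zeroCountFreq m k G i := by
    intro i hi
    rw [weightCount_range hinj, zeroCountFreq]
    refine congrArg Finset.card (Finset.filter_congr fun p _ => ?_)
    constructor
    · intro h
      have hp : p ≠ 0 := by
        rintro rfl
        rw [map_zero, hammingNorm_zero] at h
        exact (hpos i hi).ne h
      refine ⟨hp, ?_⟩
      rw [hnorm] at h
      have h1 := Nat.eq_of_mul_eq_mul_left hl0 (Nat.eq_of_mul_eq_mul_left hp0 h)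
      have := hle3 p hp
      omega
    · rintro ⟨-, h⟩
      rw [hnorm, h]
  -- The moments `j = 0, 1, 2, 3` form a triangular system in the four frequencies, solved from `j =
  -- 3` downwards.
  have hmom : ∀ j, j ≤ 3 → _ := fun j hj =>
    sum_choose_mul_zeroCountFreq (j := j) hm0 hkm hF hG (by omega) (by omega)
  have m0 := hmom 0 (by norm_num)
  have m1 := hmom 1 (by norm_num)
  have m2 := hmom 2 (by norm_num)
  have m3 := hmom 3 (by norm_num)
  simp only [Finset.sum_range_succ, Finset.sum_range_zero, Nat.choose_zero_right,
    Nat.choose_one_right, Nat.choose_self, Nat.choose_zero_succ, zero_add, one_mul, zero_mul,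
    Nat.sub_zero, show Nat.choose 1 2 = 0 from rfl, show Nat.choose 1 3 = 0 from rfl,
    show Nat.choose 2 3 = 0 from rfl, show Nat.choose 3 2 = 3 from rfl, Nat.reduceSub,
    pow_one] at m0 m1 m2 m3
  have hQl : (G.card : ℚ) * l = 2 ^ m + 1 := by exact_mod_cast hGl
  have hlq : (l : ℚ) ≠ 0 := by exact_mod_cast hl0.ne'
  have hpowZ : (2 : ℤ) ^ (2 * m - 1) = 2 ^ m * 2 ^ (m - 1) := by
    rw [← pow_add]
    congr 1
    omega
  have hweight : ∀ i, i ≤ 3 → ((2 ^ (m - 1) * (l * (G.card - i)) : ℕ) : ℤ) =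
      2 ^ (2 * m - 1) - (i * (l : ℤ) - 1) * 2 ^ (m - 1) := by
    intro i hi
    have hGlZ : (G.card : ℤ) * l = 2 ^ m + 1 := by exact_mod_cast hGl
    rw [hpowZ]
    push_cast [Nat.cast_sub (show i ≤ G.card by omega)]
    linear_combination (2 ^ (m - 1)) * hGlZ
  have q2 : (2 : ℚ) ^ (2 * m) = (2 ^ m) ^ 2 := by rw [pow_mul']
  have q2' : (2 : ℚ) ^ (2 * m + 1) = 2 * (2 ^ m) ^ 2 := by rw [pow_succ, q2]; ring
  have q4 : (2 : ℚ) ^ (m + 2) = 4 * 2 ^ m := by rw [pow_add]; ring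
  -- Eliminating `2 ^ m` turns the frequency formulas into rational identities in `|G|` and `l`
  -- alone.
  have hQ : (2 : ℚ) ^ m = G.card * l - 1 := by rw [hQl]; ring
  have c0 := congrArg (Nat.cast (R := ℚ)) m0
  have c1 := congrArg (Nat.cast (R := ℚ)) m1
  have c2 := congrArg (Nat.cast (R := ℚ)) m2
  have c3 := congrArg (Nat.cast (R := ℚ)) m3
  push_cast [cast_choose_three, Nat.cast_choose_two] at c0 c1 c2 c3
  rw [hQ] at c0 c1 c2 c3
  have n3 : (zeroCountFreq m k G 3 : ℚ) =
      (G.card * (G.card - 1) * (G.card - 2) / 6) * (G.card * l - 2) := by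
    linear_combination c3
  have n2 : (zeroCountFreq m k G 2 : ℚ) =
      (G.card * (G.card - 1) / 2) * ((G.card * l - 1) ^ 2 - 1) - 3 * zeroCountFreq m k G 3 := by
    linear_combination c2
  have n1 : (zeroCountFreq m k G 1 : ℚ) = G.card * ((G.card * l - 1) ^ 3 - 1)
      - 2 * zeroCountFreq m k G 2 - 3 * zeroCountFreq m k G 3 := by
    linear_combination c1
  have n0 : (zeroCountFreq m k G 0 : ℚ) = ((G.card * l - 1) ^ 4 - 1)
      - zeroCountFreq m k G 1 - zeroCountFreq m k G 2 - zeroCountFreq m k G 3 := by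
    linear_combination c0
  refine ⟨?_, 2 ^ (m - 1) * (l * (G.card - 3)), 2 ^ (m - 1) * (l * (G.card - 2)),
    2 ^ (m - 1) * (l * (G.card - 1)), 2 ^ (m - 1) * (l * (G.card - 0)),
    hweight 3 (by norm_num), hweight 2 (by norm_num), ?_, ?_, ?_, ?_, ?_, ?_, ?_, ?_, ?_⟩
  · rw [LinearMap.finrank_range_of_inj hinj, Module.finrank_prod]
    have := Module.card_eq_pow_finrank (K := ZMod 2) (V := F)
    rw [hF, ZMod.card] at this
    have := Nat.pow_right_injective le_rfl this
    omega
  · simpa using hweight 1 (by norm_num)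
  · simpa using hweight 0 (by norm_num)
  · apply isMinDistance_of_hammingNorm
    · rintro _ ⟨p, rfl⟩ hp
      have h0 : p ≠ 0 := by
        rintro rfl
        exact hp (map_zero T)
      rw [hnorm]
      have := hle3 p h0
      gcongr
    · have hn3 : 0 < zeroCountFreq m k G 3 := by
        have hc : 0 < G.card.choose 3 := Nat.choose_pos (by omega)
        have h2 : 2 ≤ 2 ^ m := Nat.le_self_pow hm0 2
        nlinarith
      obtain ⟨p, hp⟩ := Finset.card_pos.mp hn3
      obtain ⟨hp0, hp3⟩ := (Finset.mem_filter.mp hp).2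
      refine ⟨T p, ⟨p, rfl⟩, fun h => hp0 (hinj (by rw [h, map_zero])), ?_⟩
      rw [hnorm, hp3]
  · rw [weightCount_range hinj, Finset.card_eq_one]
    refine ⟨0, ?_⟩
    ext p
    simp only [Finset.mem_filter, Finset.mem_univ, true_and, hammingNorm_eq_zero,
      Finset.mem_singleton, map_eq_zero_iff T hinj]
  · rw [hcount 3 (by norm_num), n3, q2, hQ]
    field_simp
    ring
  · rw [hcount 2 (by norm_num), n2, n3, q2, hQ]
    field_simp
    ring
  · rw [hcount 1 (by norm_num), n1, n2, n3, q2, q2', q4, hQ]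
    field_simp
    ring
  · rw [hcount 0 (by norm_num), n0, n1, n2, n3, q2, hQ]
    field_simp
    ring
  · intro w h0 h1 h2 h3 h4
    rw [weightCount_range hinj, Finset.card_eq_zero, Finset.filter_eq_empty_iff]
    rintro p - rfl
    have hp : p ≠ 0 := by
      rintro rfl
      simp at h0
    rw [hnorm] at h1 h2 h3 h4
    have := hle3 p hp
    generalize (formZeros m k G p).card = i at *
    interval_cases i
    · exact h4 rfl
    · exact h3 rfl
    · exact h2 rfl
    · exact h1 rfl
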